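/- Let $n\ge 2$. For $1\le i\le n$ let $g_i=Z_{i-1}X_iZ_{i+1}$ be the stabilizer generators of the $n$-qubit linear cluster state, where $X_j,Z_j$ are the Pauli operators on qubit $j$ and factors with index $0$ or $n+1$ are omitted. Then for every $a\in\{0,1\}^n$ there is a unit vector $|a\rangle$ (a graph-state basis vector) with $g_i|a\rangle=(-1)^{a_i}|a\rangle$ for all $i$, and any choice of such vectors is an orthonormal basis of $(\mathbb C^2)^{\otimes n}$; $|Cl_n\rangle=|0\cdots0\rangle$ is the linear cluster state. For $k\ge 1$ let $V_k\subseteq\{0,1\}^n$ be the set of bit strings $a$ for which $k$ is the largest number of positions $i$ with $a_i=1$ that have pairwise distance larger than $2$. Every $a\neq 0$ lies in exactly one $V_k$ with $1\le k\le\lceil n/3\rceil$. Put $$\mathcal W_{Cl_n}=\sum_{k=1}^{\lceil n/3\rceil}\ \sum_{a\in V_k}\frac{1}{2^k-1}\,|a\rangle\langle a|\;-\;|Cl_n\rangle\langle Cl_n| .$$ Call a pure state biseparable if it is a product $\psi_A\otimes\psi_{\bar A}$ for some partition of the qubits into two nonempty sets $A,\bar A$; call a mixed state biseparable if it is a finite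 mixture of pure biseparable states (possibly for different partitions), and genuinely multipartite entangled (GME) otherwise. Then $\mathcal W_{Cl_n}$ is a GME witness: it is Hermitian, $\operatorname{Tr}(\mathcal W_{Cl_n}\rho)\ge 0$ for every biseparable state $\rho$, and $\operatorname{Tr}(\mathcal W_{Cl_n}\rho)<0$ for some GME state $\rho$. In fact $|Cl_n\rangle$ is GME and $\operatorname{Tr}(\mathcal W_{Cl_n}|Cl_n\rangle\langle Cl_n|)=-1$. Moreover, $\mathcal W_{Cl_n}$ is diagonal in the graph-state basis: $\mathcal W_{Cl_n}|Cl_n\rangle=-|Cl_n\rangle$, and $\mathcal W_{Cl_n}|a\rangle=(2^k-1)^{-1}|a\rangle$ for $a\in V_k$, $k\ge1$. -/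

import Mathlib

namespace ClusterWitness

/-- Bit strings of length `n`; they label the computational basis of `n` qubits. -/
abbrev BitString (n : ℕ) : Type := Fin n → Fin 2

/-- State vectors of `n` qubits, with the Hilbert space norm. -/
abbrev Ket (n : ℕ) : Type := EuclideanSpace ℂ (BitString n)

/-- Operators on `n` qubits, as matrices in the computational basis. -/
abbrev Op (n : ℕ) : Type := Matrix (BitString n) (BitString n) ℂ

/-- The rank-one operator `|ψ⟩⟨ψ|`. -/
def proj {n : ℕ} (ψ : Ket n) : Op n :=
  Matrix.vecMulVec ψ.ofLp (star ψ.ofLp)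

/-! ### Biseparability and witnesses -/

/-- `ψ = ψ_A ⊗ ψ_Ā` for some bipartition of the qubits into two nonempty parts. -/
def IsBiseparableKet {n : ℕ} (ψ : Ket n) : Prop :=
  ∃ A : Finset (Fin n), A.Nonempty ∧ A ≠ Finset.univ ∧
    ∃ (u : ({i : Fin n // i ∈ A} → Fin 2) → ℂ) (v : ({i : Fin n // i ∉ A} → Fin 2) → ℂ),
      ∀ x : BitString n, ψ x = u (fun i => x i.1) * v (fun i => x i.1)

open scoped ComplexOrder in
/-- Density operators. -/
def IsState {n : ℕ} (ρ : Op n) : Prop :=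
  ρ.PosSemidef ∧ ρ.trace = 1

/-- Biseparable states: finite mixtures of pure biseparable states, where the bipartition
may vary from one term to the next. -/
def IsBiseparable {n : ℕ} (ρ : Op n) : Prop :=
  ρ ∈ convexHull ℝ {σ : Op n | ∃ ψ : Ket n, ‖ψ‖ = 1 ∧ IsBiseparableKet ψ ∧ σ = proj ψ}

/-- Genuinely multipartite entangled states. -/
def IsGME {n : ℕ} (ρ : Op n) : Prop :=
  IsState ρ ∧ ¬ IsBiseparable ρ

/-- GME witnesses: observables with nonnegative expectation value on every biseparable state
and negative expectation value on at least one genuinely multipartite entangled state. -/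
def IsGMEWitness {n : ℕ} (W : Op n) : Prop :=
  W.IsHermitian ∧
    (∀ ρ : Op n, IsBiseparable ρ → 0 ≤ (W * ρ).trace.re) ∧
    ∃ ρ : Op n, IsGME ρ ∧ (W * ρ).trace.re < 0

/-! ### The linear cluster state and its graph-state basis -/

/-- The Pauli matrix `X`. -/
def pauliX : Matrix (Fin 2) (Fin 2) ℂ := !![0, 1; 1, 0]

/-- The Pauli matrix `Z`. -/
def pauliZ : Matrix (Fin 2) (Fin 2) ℂ := !![1, 0; 0, -1]

/-- The tensor product `P₁ ⊗ ⋯ ⊗ Pₙ` of single-qubit operators. -/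
def tensorOp {n : ℕ} (P : Fin n → Matrix (Fin 2) (Fin 2) ℂ) : Op n :=
  Matrix.of fun x y => ∏ j, P j (x j) (y j)

/-- The stabilizer generator `g_i = Z_{i-1} X_i Z_{i+1}` of the linear cluster state
(a factor whose index is out of range is absent). -/
def stabilizer (n : ℕ) (i : Fin n) : Op n :=
  tensorOp fun j =>
    if j = i then pauliX
    else if (j : ℕ) + 1 = i ∨ (i : ℕ) + 1 = j then pauliZ
    else 1

/-- `b a` is a unit vector `|a⟩` with `g_i |a⟩ = (-1)^{a_i} |a⟩` for all `i`.  This determines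
each `|a⟩` up to a phase; `|0⋯0⟩` is the linear cluster state itself. -/
def IsClusterBasis (n : ℕ) (b : BitString n → Ket n) : Prop :=
  ∀ a : BitString n, ‖b a‖ = 1 ∧
    ∀ i : Fin n,
      (stabilizer n i).mulVec (b a).ofLp = ((-1 : ℂ) ^ (a i : ℕ)) • (b a).ofLp

/-! ### The witness -/

/-- `T` is a set of positions of `1`s of `a` that have pairwise distance larger than `2`. -/
def IsSpread {n : ℕ} (a : BitString n) (T : Finset (Fin n)) : Prop :=
  (∀ i ∈ T, a i = 1) ∧ ∀ i ∈ T, ∀ j ∈ T, i < j → (i : ℕ) + 2 < j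

open Classical in
/-- The bit strings for which the largest number of `1`s with pairwise distance larger
than `2` is exactly `k`. -/
noncomputable def V (n k : ℕ) : Finset (BitString n) :=
  Finset.univ.filter fun a =>
    IsGreatest {m : ℕ | ∃ T : Finset (Fin n), IsSpread a T ∧ T.card = m} k

/-- The operator `∑_{k=1}^{⌈n/3⌉} ∑_{a ∈ V_k} (2^k - 1)⁻¹ |a⟩⟨a| - |0⋯0⟩⟨0⋯0|` for a
graph-state basis `b`. -/
noncomputable def witness (n : ℕ) (b : BitString n → Ket n) : Op n :=
  (∑ k ∈ Finset.Icc 1 ⌈(n : ℚ) / 3⌉₊, ∑ a ∈ V n k, ((2 : ℂ) ^ k - 1)⁻¹ • proj (b a))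
    - proj (b 0)

end ClusterWitness

/-! Up to phases, $|a\rangle$ has amplitudes $2^{-n/2}(-1)^{a\cdot x+e(x)}$, where $e(x)$ counts the
edges of the path inside the support of $x$. Orthonormality and the eigenvalues then follow from
character sums over $\mathbb F_2$. What remains is to show $|\langle
0|\psi\rangle|^2\le\sum_{a\ne0}(2^{k(a)}-1)^{-1}|\langle a|\psi\rangle|^2$ for a product vector
$\psi$ across $A|\bar A$.

Edges inside $A$ or inside $\bar A$ give local signs, absorbed into the two factors; only the
crossing edges, a matrix $M$ over $\mathbb F_2$, couple the parts. Put $N=|\operatorname{im}M^T|$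
and $L=\operatorname{im}M\times\operatorname{im}M^T$. Parseval and Cauchy–Schwarz give
$N|\langle0|\psi\rangle|^2\le\sum_{a\in L}|\langle a|\psi\rangle|^2$
(`card_mul_norm_overlap_zero_sq_le`). Separated ones of $a\in L$ select independent columns of
$M^T$, so $2^{k(a)}\le N$ (`two_pow_card_le_card_imageMulVec`). Removing $a=0$ and dividing by
$N-1>0$ gives the claim; mixtures follow by convexity. -/

namespace ClusterWitness

/-! ### Characters of elementary abelian 2-groups -/

section Characters

open scoped Fin.CommRing

/-- The nontrivial character of `Fin 2`. -/
noncomputable def sgn (b : Fin 2) : ℂ := (-1) ^ (b : ℕ)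

@[simp] theorem sgn_zero : sgn 0 = 1 := by simp [sgn]

@[simp] theorem sgn_one : sgn 1 = -1 := by simp [sgn]

theorem sgn_add (b c : Fin 2) : sgn (b + c) = sgn b * sgn c := by
  fin_cases b <;> fin_cases c <;> simp [sgn]

theorem sgn_mul_self (b : Fin 2) : sgn b * sgn b = 1 := by
  fin_cases b <;> simp [sgn]

@[simp] theorem conj_sgn (b : Fin 2) : (starRingEnd ℂ) (sgn b) = sgn b := by
  simp [sgn]

@[simp] theorem norm_sgn (b : Fin 2) : ‖sgn b‖ = 1 := by
  simp [sgn]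

theorem bit_add_self {I : Type*} (x : I → Fin 2) : x + x = 0 := by
  ext i : 1
  have : ∀ b : Fin 2, b + b = 0 := by decide
  exact this _

theorem bit_add_add_cancel {I : Type*} (x y : I → Fin 2) : x + y + y = x := by
  rw [add_assoc, bit_add_self, add_zero]

theorem bit_eq_one_of_ne_zero {b : Fin 2} (h : b ≠ 0) : b = 1 := by
  revert b; decide

variable {I J : Type*} [Fintype I] [Fintype J] [DecidableEq I] [DecidableEq J]

/-- If $w_i=1$, translating $y$ by the $i$-th unit vector flips every sign, so the sum equals its
own negative. -/
theorem sum_sgn_dotProduct (w : I → Fin 2) :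
    ∑ y : I → Fin 2, sgn (w ⬝ᵥ y) = if w = 0 then (2 : ℂ) ^ Fintype.card I else 0 := by
  split_ifs with h
  · subst h
    simp
  · obtain ⟨i, hi⟩ := Function.ne_iff.mp h
    have hi : w i = 1 := bit_eq_one_of_ne_zero hi
    have h1 : ∑ y : I → Fin 2, sgn (w ⬝ᵥ y) = ∑ y : I → Fin 2, - sgn (w ⬝ᵥ y) := by
      refine Fintype.sum_equiv (Equiv.addRight (Pi.single i 1)) _ _ fun y => ?_
      simp [dotProduct_add, sgn_add, hi]
    rw [Finset.sum_neg_distrib] at h1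
    exact self_eq_neg.mp h1

theorem parseval (f : (I → Fin 2) → ℂ) :
    ∑ y : I → Fin 2, ‖∑ w, sgn (w ⬝ᵥ y) * f w‖ ^ 2
      = 2 ^ Fintype.card I * ∑ w, ‖f w‖ ^ 2 := by
  have key : ∑ y : I → Fin 2,
      (∑ w, sgn (w ⬝ᵥ y) * f w) * (starRingEnd ℂ) (∑ w, sgn (w ⬝ᵥ y) * f w)
      = 2 ^ Fintype.card I * ∑ w, f w * (starRingEnd ℂ) (f w) := by
    calc _ = ∑ y : I → Fin 2, ∑ w, ∑ w',
            sgn ((w + w') ⬝ᵥ y) * (f w * (starRingEnd ℂ) (f w')) := by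
          refine Finset.sum_congr rfl fun y _ => ?_
          rw [map_sum, Finset.sum_mul_sum]
          refine Finset.sum_congr rfl fun w _ => Finset.sum_congr rfl fun w' _ => ?_
          rw [add_dotProduct, sgn_add, map_mul, conj_sgn]
          ring
      _ = ∑ w, ∑ w', (∑ y : I → Fin 2, sgn ((w + w') ⬝ᵥ y))
            * (f w * (starRingEnd ℂ) (f w')) := by
          rw [Finset.sum_comm]
          refine Finset.sum_congr rfl fun w _ => ?_
          rw [Finset.sum_comm]
          exact Finset.sum_congr rfl fun w' _ => (Finset.sum_mul _ _ _).symm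
      _ = _ := by
          rw [Finset.mul_sum]
          refine Finset.sum_congr rfl fun w _ => ?_
          rw [Finset.sum_eq_single w]
          · rw [sum_sgn_dotProduct, if_pos (bit_add_self w)]
          · intro w' _ hw
            rw [sum_sgn_dotProduct, if_neg, zero_mul]
            intro h0
            apply hw
            have := bit_add_add_cancel w w'
            rw [h0, zero_add] at this
            exact this
          · simp
  simp only [Complex.mul_conj, Complex.normSq_eq_norm_sq] at key
  exact_mod_cast key

/-! ### Overlaps of a product vector with a basis of maximally entangled vectors -/

/-- The overlap of `u ⊗ v` with the unnormalised vector
`∑ y z, (-1)^(α·y + β·z + y·Mz) |y z⟩`. -/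
noncomputable def overlap (M : Matrix I J (Fin 2)) (u : (I → Fin 2) → ℂ) (v : (J → Fin 2) → ℂ)
    (α : I → Fin 2) (β : J → Fin 2) : ℂ :=
  ∑ y, ∑ z, sgn (α ⬝ᵥ y + β ⬝ᵥ z + y ⬝ᵥ M.mulVec z) * (u y * v z)

/-- Substituting $w=Mz+\alpha$ turns the exponent into $w\cdot y+w\cdot y'+y'\cdot\alpha$. The
overlap becomes, up to sign, a Walsh transform in $y'$, ready for `parseval`. -/
theorem overlap_vecMul (M : Matrix I J (Fin 2)) (u : (I → Fin 2) → ℂ) (v : (J → Fin 2) → ℂ)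
    (α y' : I → Fin 2) :
    overlap M u v α (M.vecMul y')
      = sgn (y' ⬝ᵥ α) * ∑ w, sgn (w ⬝ᵥ y') *
          ((∑ y, sgn (w ⬝ᵥ y) * u y) * ∑ z with M.mulVec z = w + α, v z) := by
  have h : ∀ w : I → Fin 2, ∑ z with M.mulVec z = w + α, v z
      = ∑ z, if w = M.mulVec z + α then v z else 0 := by
    intro w
    rw [Finset.sum_filter]
    refine Finset.sum_congr rfl fun z _ => ?_
    congr 1
    rw [eq_iff_iff]
    constructor
    · intro h; rw [h, bit_add_add_cancel]
    · intro h; rw [h, bit_add_add_cancel]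
  simp only [h, Finset.mul_sum, mul_ite, mul_zero]
  rw [Finset.sum_comm]
  simp only [Finset.sum_ite_eq', Finset.mem_univ, if_true]
  rw [overlap, Finset.sum_comm]
  refine Finset.sum_congr rfl fun z _ => ?_
  rw [Finset.sum_mul, Finset.mul_sum, Finset.mul_sum]
  refine Finset.sum_congr rfl fun y _ => ?_
  rw [← Matrix.dotProduct_mulVec, add_dotProduct, add_dotProduct, dotProduct_comm y' α,
    dotProduct_comm y' (M.mulVec z), dotProduct_comm y (M.mulVec z)]
  simp only [sgn_add]
  linear_combination (-(sgn (α ⬝ᵥ y) * sgn (M.mulVec z ⬝ᵥ y') * sgn (M.mulVec z ⬝ᵥ y)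
    * (u y * v z))) * sgn_mul_self (α ⬝ᵥ y')

/-- The image of the linear map given by `M`. -/
def imageMulVec (M : Matrix I J (Fin 2)) : Finset (I → Fin 2) :=
  Finset.univ.image M.mulVec

theorem mem_imageMulVec {M : Matrix I J (Fin 2)} {w : I → Fin 2} :
    w ∈ imageMulVec M ↔ ∃ z, M.mulVec z = w := by
  simp [imageMulVec]

theorem add_mem_imageMulVec {M : Matrix I J (Fin 2)} {w w' : I → Fin 2}
    (h : w ∈ imageMulVec M) (h' : w' ∈ imageMulVec M) : w + w' ∈ imageMulVec M := by
  rw [mem_imageMulVec] at *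
  obtain ⟨z, rfl⟩ := h
  obtain ⟨z', rfl⟩ := h'
  exact ⟨z + z', Matrix.mulVec_add _ _ _⟩

theorem zero_mem_imageMulVec (M : Matrix I J (Fin 2)) : 0 ∈ imageMulVec M :=
  mem_imageMulVec.mpr ⟨0, Matrix.mulVec_zero _⟩

theorem card_fiber_mul_card_imageMulVec (M : Matrix I J (Fin 2)) {w : I → Fin 2}
    (hw : w ∈ imageMulVec M) :
    (Finset.univ.filter fun z => M.mulVec z = w).card * (imageMulVec M).card = 2 ^ Fintype.card J := by
  have hfib : ∀ w' ∈ imageMulVec M, (Finset.univ.filter fun z => M.mulVec z = w').card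
      = (Finset.univ.filter fun z => M.mulVec z = w).card := by
    intro w' hw'
    rw [mem_imageMulVec] at hw hw'
    exact AddMonoidHom.card_fiber_eq_of_mem_range M.mulVecLin hw' hw
  have h := Finset.card_eq_sum_card_image M.mulVec Finset.univ
  change _ = ∑ w' ∈ imageMulVec M, _ at h
  rw [Finset.sum_congr rfl hfib, Finset.sum_const, smul_eq_mul, mul_comm] at h
  rw [← h]
  simp

/-- For fixed $\alpha$, Parseval in $y'$ gives $2^{|I|}\sum_w|U(w)V(w+\alpha)|^2$. Since $V$
vanishes off the image of $M$, Cauchy–Schwarz bounds the overlap at zero by a product of two sums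
over that image. -/
theorem norm_overlap_zero_sq_le (M : Matrix I J (Fin 2)) (u : (I → Fin 2) → ℂ)
    (v : (J → Fin 2) → ℂ) :
    2 ^ Fintype.card I * ‖overlap M u v 0 0‖ ^ 2
      ≤ ∑ α ∈ imageMulVec M, ∑ y', ‖overlap M u v α (M.vecMul y')‖ ^ 2 := by
  set U : (I → Fin 2) → ℂ := fun w => ∑ y, sgn (w ⬝ᵥ y) * u y with hU
  set V : (I → Fin 2) → ℂ := fun w => ∑ z with M.mulVec z = w, v z with hV
  have hF : ∀ α y', overlap M u v α (M.vecMul y')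
      = sgn (y' ⬝ᵥ α) * ∑ w, sgn (w ⬝ᵥ y') * (U w * V (w + α)) := overlap_vecMul M u v
  have h0 : overlap M u v 0 0 = ∑ w ∈ imageMulVec M, U w * V w := by
    have := hF 0 0
    rw [Matrix.zero_vecMul] at this
    rw [this]
    simp only [dotProduct_zero, sgn_zero, one_mul, add_zero]
    symm
    apply Finset.sum_subset (Finset.subset_univ _)
    intro w _ hw
    have : V w = 0 := by
      rw [hV]
      apply Finset.sum_eq_zero
      intro z hz
      exact absurd (mem_imageMulVec.mpr ⟨z, (Finset.mem_filter.mp hz).2⟩) hw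
    rw [this, mul_zero]
  have hP : ∀ α, ∑ y', ‖overlap M u v α (M.vecMul y')‖ ^ 2
      = 2 ^ Fintype.card I * ∑ w, ‖U w * V (w + α)‖ ^ 2 := by
    intro α
    rw [← parseval]
    refine Finset.sum_congr rfl fun y' _ => ?_
    rw [hF, norm_mul, norm_sgn, one_mul]
  simp only [hP]
  rw [← Finset.mul_sum]
  refine mul_le_mul_of_nonneg_left ?_ (by positivity)
  calc ‖overlap M u v 0 0‖ ^ 2 ≤ (∑ w ∈ imageMulVec M, ‖U w‖ * ‖V w‖) ^ 2 := by
        rw [h0]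
        gcongr
        exact (norm_sum_le _ _).trans_eq (Finset.sum_congr rfl fun w _ => norm_mul _ _)
    _ ≤ (∑ w ∈ imageMulVec M, ‖U w‖ ^ 2) * ∑ w ∈ imageMulVec M, ‖V w‖ ^ 2 :=
        Finset.sum_mul_sq_le_sq_mul_sq _ _ _
    _ = ∑ w ∈ imageMulVec M, ∑ α ∈ imageMulVec M, ‖U w * V (w + α)‖ ^ 2 := by
        rw [Finset.sum_mul]
        refine Finset.sum_congr rfl fun w hw => ?_
        simp only [norm_mul, mul_pow]
        rw [← Finset.mul_sum]
        congr 1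
        -- The image is a subgroup, so translation by its element $w$ permutes it.
        refine Finset.sum_nbij' (fun x => x + w) (fun x => x + w)
          (fun x hx => add_mem_imageMulVec hx hw) (fun x hx => add_mem_imageMulVec hx hw)
          (fun x _ => bit_add_add_cancel _ _) (fun x _ => bit_add_add_cancel _ _) fun x _ => ?_
        rw [add_comm w, bit_add_add_cancel]
    _ ≤ ∑ w, ∑ α ∈ imageMulVec M, ‖U w * V (w + α)‖ ^ 2 :=
        Finset.sum_le_sum_of_subset_of_nonneg (Finset.subset_univ _)
          fun _ _ _ => Finset.sum_nonneg fun _ _ => by positivity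
    _ = _ := Finset.sum_comm

/-- The sum over $y'$ meets each $\beta=M^Ty'$ exactly $K=|\ker M^T|$ times, and
$K\,|\operatorname{im}M^T|=2^{|I|}$; cancelling $K$ leaves the image size. -/
theorem card_mul_norm_overlap_zero_sq_le (M : Matrix I J (Fin 2)) (u : (I → Fin 2) → ℂ)
    (v : (J → Fin 2) → ℂ) :
    (imageMulVec M.transpose).card * ‖overlap M u v 0 0‖ ^ 2
      ≤ ∑ α ∈ imageMulVec M, ∑ β ∈ imageMulVec M.transpose, ‖overlap M u v α β‖ ^ 2 := by
  have h := norm_overlap_zero_sq_le M u v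
  simp only [← Matrix.mulVec_transpose] at h
  set K := (Finset.univ.filter fun y => M.transpose.mulVec y = 0).card with hK
  have hcard : ∀ β ∈ imageMulVec M.transpose, (Finset.univ.filter fun y => M.transpose.mulVec y = β).card = K := by
    intro β hβ
    refine Nat.eq_of_mul_eq_mul_right
      (Finset.card_pos.mpr ⟨β, hβ⟩) ((card_fiber_mul_card_imageMulVec _ hβ).trans
        (card_fiber_mul_card_imageMulVec _ (zero_mem_imageMulVec _)).symm)
  have hfib : ∀ α, ∑ y, ‖overlap M u v α (M.transpose.mulVec y)‖ ^ 2
      = K * ∑ β ∈ imageMulVec M.transpose, ‖overlap M u v α β‖ ^ 2 := by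
    intro α
    rw [Finset.sum_comp (fun β => ‖overlap M u v α β‖ ^ 2), Finset.mul_sum]
    refine Finset.sum_congr rfl fun β hβ => ?_
    rw [hcard β hβ, nsmul_eq_mul]
  simp only [hfib] at h
  rw [← Finset.mul_sum] at h
  have hKN := card_fiber_mul_card_imageMulVec M.transpose (zero_mem_imageMulVec _)
  rw [← hK] at hKN
  have hKN' : (K : ℝ) * (imageMulVec M.transpose).card = 2 ^ Fintype.card I := by
    exact_mod_cast hKN
  have hKpos : (0 : ℝ) < K := by
    have : K ≠ 0 := by
      rintro h0
      rw [h0, zero_mul] at hKN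
      exact absurd hKN.symm (by positivity)
    positivity
  rw [← hKN', mul_assoc] at h
  exact le_of_mul_le_mul_left h hKpos

end Characters

end ClusterWitness
namespace ClusterWitness

section Combinatorics

open scoped Fin.CommRing

variable {n : ℕ}

/-! ### The cut of a bipartition of the path graph -/

/-- The edges of the path graph that cross the bipartition `A | Aᶜ`. -/
def cutMatrix (A : Finset (Fin n)) :
    Matrix {i : Fin n // i ∈ A} {i : Fin n // i ∉ A} (Fin 2) :=
  Matrix.of fun i j => if (i.1 : ℕ) + 1 = j.1 ∨ (j.1 : ℕ) + 1 = i.1 then 1 else 0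

theorem cutMatrix_ne_zero {A : Finset (Fin n)} {i : {i : Fin n // i ∈ A}}
    {j : {i : Fin n // i ∉ A}} :
    cutMatrix A i j ≠ 0 ↔ (i.1 : ℕ) + 1 = j.1 ∨ (j.1 : ℕ) + 1 = i.1 := by
  simp [cutMatrix, or_iff_not_imp_left]

/-- The path is connected: without a crossing edge, membership in $A$ would propagate from vertex
$0$ to all vertices. -/
theorem exists_cutMatrix_ne_zero {A : Finset (Fin n)} (hA : A.Nonempty)
    (hA' : A ≠ Finset.univ) : ∃ i j, cutMatrix A i j ≠ 0 := by
  by_contra! h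
  have step : ∀ i j : Fin n, (i : ℕ) + 1 = j → (i ∈ A ↔ j ∈ A) := by
    intro i j hij
    by_contra hne
    by_cases hi : i ∈ A
    · have hj : j ∉ A := fun hj => hne (iff_of_true hi hj)
      exact cutMatrix_ne_zero.mpr (Or.inl hij) (h ⟨i, hi⟩ ⟨j, hj⟩)
    · have hj : j ∈ A := by
        by_contra hj
        exact hne (iff_of_false hi hj)
      exact cutMatrix_ne_zero.mpr (Or.inr hij) (h ⟨j, hj⟩ ⟨i, hi⟩)
  obtain ⟨i₀, hi₀⟩ := hA
  have hpos : 0 < n := i₀.pos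
  have all : ∀ m (hm : m < n), (⟨m, hm⟩ ∈ A ↔ (⟨0, hpos⟩ : Fin n) ∈ A) := by
    intro m
    induction m with
    | zero => exact fun _ => Iff.rfl
    | succ m ih =>
      intro hm
      exact (step ⟨m, by omega⟩ ⟨m + 1, hm⟩ rfl).symm.trans (ih _)
  apply hA'
  ext j
  simpa using (all j j.2).mpr ((all i₀ i₀.2).mp hi₀)

theorem one_lt_card_imageMulVec_cutMatrix {A : Finset (Fin n)} (hA : A.Nonempty)
    (hA' : A ≠ Finset.univ) : 1 < (imageMulVec (cutMatrix A).transpose).card := by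
  obtain ⟨i, j, hij⟩ := exists_cutMatrix_ne_zero hA hA'
  refine Finset.one_lt_card.mpr ⟨0, zero_mem_imageMulVec _, _,
    mem_imageMulVec.mpr ⟨Pi.single i 1, rfl⟩, fun h => hij ?_⟩
  simpa using (congrFun h j).symm

theorem exists_ne_zero_of_mem_imageMulVec {I J : Type*} [Fintype I] [Fintype J] [DecidableEq I]
    [DecidableEq J] {M : Matrix I J (Fin 2)} {w : I → Fin 2} (hw : w ∈ imageMulVec M) {i : I}
    (hi : w i = 1) : ∃ j, M i j ≠ 0 := by
  obtain ⟨z, rfl⟩ := mem_imageMulVec.mp hw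
  by_contra! h
  simp [Matrix.mulVec, dotProduct, h] at hi

/-- The cut rank is at least the number of separated `1`s of a string in the image. -/
theorem two_pow_card_le_card_imageMulVec {A : Finset (Fin n)} {a : BitString n}
    (hα : (fun i : {i : Fin n // i ∈ A} => a i.1) ∈ imageMulVec (cutMatrix A))
    (hβ : (fun i : {i : Fin n // i ∉ A} => a i.1) ∈ imageMulVec (cutMatrix A).transpose)
    {T : Finset (Fin n)} (hT : IsSpread a T) :
    2 ^ T.card ≤ (imageMulVec (cutMatrix A).transpose).card := by
  -- A one in a vector of the image forces a nonzero row of the matrix, so each $t\in T$ is an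
  -- endpoint of a crossing edge $r_tc_t$.
  have hex : ∀ t : T, ∃ (r : {i : Fin n // i ∈ A}) (c : {i : Fin n // i ∉ A}),
      cutMatrix A r c ≠ 0 ∧ (t.1 = r.1 ∨ t.1 = c.1) := by
    rintro ⟨t, ht⟩
    by_cases htA : t ∈ A
    · obtain ⟨j, hj⟩ := exists_ne_zero_of_mem_imageMulVec hα (i := ⟨t, htA⟩) (hT.1 t ht)
      exact ⟨_, j, hj, Or.inl rfl⟩
    · obtain ⟨j, hj⟩ := exists_ne_zero_of_mem_imageMulVec hβ (i := ⟨t, htA⟩) (hT.1 t ht)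
      exact ⟨j, _, hj, Or.inr rfl⟩
  choose r c hrc hor using hex
  -- An edge $r_tc_s$ joins $s$ and $t$ by a walk of length at most 2, contradicting separation,
  -- unless $t=c_t$ and $s=r_s$, where the walk has length 3.
  have hsep : ∀ s t : T, t ≠ s → cutMatrix A (r t) (c s) ≠ 0 →
      t.1 = (c t).1 ∧ s.1 = (r s).1 := by
    intro s t hts hne
    have hfar : (s.1 : ℕ) + 2 < t.1 ∨ (t.1 : ℕ) + 2 < s.1 := by
      rcases lt_trichotomy s.1 t.1 with h | h | h
      · exact Or.inl (hT.2 _ s.2 _ t.2 h)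
      · exact absurd (Subtype.ext h.symm) hts
      · exact Or.inr (hT.2 _ t.2 _ s.2 h)
    have h1 := cutMatrix_ne_zero.mp hne
    have h2 := cutMatrix_ne_zero.mp (hrc s)
    have h3 := cutMatrix_ne_zero.mp (hrc t)
    rcases hor t with ht | ht <;> rcases hor s with hs | hs
    · have ht' := congrArg Fin.val ht
      have hs' := congrArg Fin.val hs
      omega
    · have ht' := congrArg Fin.val ht
      have hs' := congrArg Fin.val hs
      omega
    · exact ⟨ht, hs⟩
    · have ht' := congrArg Fin.val ht
      have hs' := congrArg Fin.val hs
      omega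
  have heval : ∀ (d : T → Fin 2) (s : T),
      (cutMatrix A).transpose.mulVec (∑ t, Pi.single (r t) (d t)) (c s)
        = ∑ t, cutMatrix A (r t) (c s) * d t := by
    intro d s
    rw [Matrix.mulVec_sum, Finset.sum_apply]
    refine Finset.sum_congr rfl fun t _ => ?_
    simp [Matrix.mulVec_single]
  -- By `hsep` the matrix $(M_{r_t,c_s})$ is block triangular with unit diagonal: the equations for
  -- $s\notin A$ are solved first, then those for $s\in A$.
  have hker : ∀ d : T → Fin 2, (∀ s, ∑ t, cutMatrix A (r t) (c s) * d t = 0) → d = 0 := by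
    intro d hd
    have hone : ∀ s : T, cutMatrix A (r s) (c s) = 1 := fun s => bit_eq_one_of_ne_zero (hrc s)
    have hB : ∀ s : T, s.1 = (c s).1 → d s = 0 := by
      intro s hs
      have h := hd s
      rw [Finset.sum_eq_single s, hone, one_mul] at h
      · exact h
      · intro t _ hts
        by_contra hne
        have := (hsep s t hts (left_ne_zero_of_mul hne)).2
        exact (c s).2 (hs ▸ this ▸ (r s).2)
      · simp
    funext s
    rcases hor s with hs | hs
    · have h := hd s
      rw [Finset.sum_eq_single s, hone, one_mul] at h
      · exact h
      · intro t _ hts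
        by_contra hne
        exact right_ne_zero_of_mul hne (hB t (hsep s t hts (left_ne_zero_of_mul hne)).1)
      · simp
    · exact hB s hs
  have hcard : (Finset.univ : Finset (T → Fin 2)).card = 2 ^ T.card := by simp
  rw [← hcard]
  refine Finset.card_le_card_of_injOn
    (fun d => (cutMatrix A).transpose.mulVec (∑ t, Pi.single (r t) (d t)))
    (fun d _ => mem_imageMulVec.mpr ⟨_, rfl⟩) ?_
  intro d _ d' _ hdd
  have h0 : d + d' = 0 := by
    apply hker
    intro s
    have h := congrFun hdd (c s)
    simp only [heval] at h
    simp only [Pi.add_apply, mul_add, Finset.sum_add_distrib, h]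
    exact (by decide : ∀ b : Fin 2, b + b = 0) _
  have := bit_add_add_cancel d d'
  rw [h0, zero_add] at this
  exact this.symm

/-! ### The classes of bit strings -/

open Classical in
/-- The largest number of `1`s of `a` that have pairwise distance larger than `2`. -/
noncomputable def spreadNumber (a : BitString n) : ℕ :=
  (Finset.univ.filter (IsSpread a)).sup Finset.card

theorem IsSpread.card_le {a : BitString n} {T : Finset (Fin n)} (hT : IsSpread a T) :
    T.card ≤ spreadNumber a := by
  classical
  exact Finset.le_sup (f := Finset.card) (Finset.mem_filter.mpr ⟨Finset.mem_univ _, hT⟩)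

theorem isSpread_empty (a : BitString n) : IsSpread a ∅ := by simp [IsSpread]

theorem exists_isSpread_card_eq (a : BitString n) :
    ∃ T, IsSpread a T ∧ T.card = spreadNumber a := by
  classical
  obtain ⟨T, hT, h⟩ := Finset.exists_mem_eq_sup (Finset.univ.filter (IsSpread a))
    ⟨∅, Finset.mem_filter.mpr ⟨Finset.mem_univ _, isSpread_empty a⟩⟩ Finset.card
  exact ⟨T, (Finset.mem_filter.mp hT).2, h.symm⟩

theorem mem_V {k : ℕ} {a : BitString n} : a ∈ V n k ↔ spreadNumber a = k := by
  classical
  have h : IsGreatest {m : ℕ | ∃ T : Finset (Fin n), IsSpread a T ∧ T.card = m}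
      (spreadNumber a) :=
    ⟨exists_isSpread_card_eq a, by rintro m ⟨T, hT, rfl⟩; exact hT.card_le⟩
  rw [V, Finset.mem_filter]
  constructor
  · rintro ⟨_, h'⟩
    exact h.unique h'
  · rintro rfl
    exact ⟨Finset.mem_univ _, h⟩

theorem spreadNumber_zero : spreadNumber (0 : BitString n) = 0 := by
  obtain ⟨T, hT, h⟩ := exists_isSpread_card_eq (0 : BitString n)
  rw [← h, Finset.card_eq_zero, Finset.eq_empty_iff_forall_notMem]
  intro i hi
  simpa using hT.1 i hi

theorem one_le_spreadNumber {a : BitString n} (ha : a ≠ 0) : 1 ≤ spreadNumber a := by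
  obtain ⟨i, hi⟩ := Function.ne_iff.mp ha
  have h : IsSpread a {i} := by
    refine ⟨fun j hj => ?_, fun j hj l hl hjl => ?_⟩
    · rw [Finset.mem_singleton.mp hj]
      exact bit_eq_one_of_ne_zero hi
    · rw [Finset.mem_singleton.mp hj, Finset.mem_singleton.mp hl] at hjl
      exact absurd hjl (lt_irrefl _)
  simpa using h.card_le

/-- Each block of three consecutive positions contains at most one element of a spread set. -/
theorem spreadNumber_le (a : BitString n) : spreadNumber a ≤ ⌈(n : ℚ) / 3⌉₊ := by
  obtain ⟨T, hT, h⟩ := exists_isSpread_card_eq a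
  rw [← h, ← Finset.card_range ⌈(n : ℚ) / 3⌉₊]
  refine Finset.card_le_card_of_injOn (fun i => (i : ℕ) / 3) (fun i _ => ?_) ?_
  · have hi : ((i : ℕ) / 3 : ℕ) < (n : ℚ) / 3 :=
      lt_of_le_of_lt Nat.cast_div_le (by
        have : ((i : ℕ) : ℚ) < n := by exact_mod_cast i.2
        push_cast
        linarith)
    simpa using Nat.lt_ceil.mpr hi
  · intro i hi j hj hij
    simp only at hij
    rcases lt_trichotomy i j with hlt | heq | hlt
    · have := hT.2 i hi j hj hlt
      omega
    · exact heq
    · have := hT.2 j hj i hi hlt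
      omega

theorem existsUnique_mem_V {a : BitString n} (ha : a ≠ 0) :
    ∃! k : ℕ, k ∈ Finset.Icc 1 ⌈(n : ℚ) / 3⌉₊ ∧ a ∈ V n k :=
  ⟨spreadNumber a, ⟨Finset.mem_Icc.mpr ⟨one_le_spreadNumber ha, spreadNumber_le a⟩,
    mem_V.mpr rfl⟩, fun _ h => (mem_V.mp h.2).symm⟩

theorem sum_sum_V {E : Type*} [AddCommMonoid E] (f : ℕ → BitString n → E) :
    ∑ k ∈ Finset.Icc 1 ⌈(n : ℚ) / 3⌉₊, ∑ a ∈ V n k, f k a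
      = ∑ a ∈ Finset.univ.erase 0, f (spreadNumber a) a := by
  rw [← Finset.sum_fiberwise_of_maps_to (t := Finset.Icc 1 ⌈(n : ℚ) / 3⌉₊)
    (g := spreadNumber) fun a ha => Finset.mem_Icc.mpr
      ⟨one_le_spreadNumber (Finset.ne_of_mem_erase ha), spreadNumber_le a⟩]
  refine Finset.sum_congr rfl fun k hk => ?_
  have hk1 := (Finset.mem_Icc.mp hk).1
  refine Finset.sum_congr ?_ fun a ha => ?_
  · ext a
    simp only [mem_V, Finset.mem_filter, Finset.mem_erase, Finset.mem_univ, and_true]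
    refine ⟨fun h => ⟨?_, h⟩, fun h => h.2⟩
    rintro rfl
    rw [spreadNumber_zero] at h
    omega
  · rw [(Finset.mem_filter.mp ha).2]

end Combinatorics

end ClusterWitness
namespace ClusterWitness

section ClusterKet

open scoped Fin.CommRing

variable {n : ℕ}

/-! ### The graph-state basis in the computational basis -/

/-- The number of edges of the path graph inside the support of `x`, modulo `2`. -/
def edgeForm (x : BitString n) : Fin 2 :=
  ∑ i : Fin n, ∑ j : Fin n, if (i : ℕ) + 1 = j then x i * x j else 0

/-- The sum of the bits at the neighbours of `i`. -/
def neighborSum (i : Fin n) (x : BitString n) : Fin 2 :=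
  ∑ j : Fin n, if (j : ℕ) + 1 = i ∨ (i : ℕ) + 1 = j then x j else 0

/-- The graph-state basis vector with label `a`. -/
noncomputable def clusterKet (a : BitString n) : Ket n :=
  WithLp.toLp 2 fun x => ((√2 : ℂ) ^ n)⁻¹ * sgn (a ⬝ᵥ x + edgeForm x)

/-- Flipping bit $i$ toggles exactly the edges from $i$ to neighbours carrying a one. This sign
cancels the $Z$ factors of the stabilizer. -/
theorem edgeForm_add_single (x : BitString n) (i : Fin n) :
    edgeForm (x + Pi.single i 1) = edgeForm x + neighborSum i x := by
  have hterm : ∀ k l : Fin n,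
      (if (k : ℕ) + 1 = l then (x + Pi.single i 1 : BitString n) k * (x + Pi.single i 1 : BitString n) l else 0)
      = (if (k : ℕ) + 1 = l then x k * x l else 0)
        + ((if k = i then (if (i : ℕ) + 1 = l then x l else 0) else 0)
          + (if l = i then (if (k : ℕ) + 1 = i then x k else 0) else 0)) := by
    intro k l
    by_cases hkl : (k : ℕ) + 1 = l
    · by_cases hk : k = i
      · subst hk
        have hl : l ≠ k := by rintro rfl; omega
        simp [hkl, hl, add_mul]
      · by_cases hl : l = i
        · subst hl
          simp [hkl, hk, mul_add]
        · simp [hkl, hk, hl]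
    · by_cases hk : k = i
      · subst hk
        by_cases hl : l = k
        · subst hl; simp
        · simp [hkl, hl]
      · by_cases hl : l = i
        · subst hl; simp [hkl, hk]
        · simp [hkl, hk, hl]
  simp only [edgeForm, hterm, Finset.sum_add_distrib]
  congr 1
  have h1 : ∑ k : Fin n, ∑ l : Fin n, (if k = i then (if (i : ℕ) + 1 = l then x l else 0) else 0)
      = ∑ l : Fin n, if (i : ℕ) + 1 = l then x l else 0 := by
    rw [Finset.sum_comm]
    simp
  have h2 : ∑ k : Fin n, ∑ l : Fin n, (if l = i then (if (k : ℕ) + 1 = i then x k else 0) else 0)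
      = ∑ k : Fin n, if (k : ℕ) + 1 = i then x k else 0 := by
    simp
  rw [h1, h2, ← Finset.sum_add_distrib, neighborSum]
  refine Finset.sum_congr rfl fun j _ => ?_
  by_cases h : (j : ℕ) + 1 = i
  · have h' : ¬ (i : ℕ) + 1 = j := by omega
    simp [h, h']
  · simp [h]

theorem sgn_sum {ι : Type*} (s : Finset ι) (f : ι → Fin 2) :
    sgn (∑ i ∈ s, f i) = ∏ i ∈ s, sgn (f i) := by
  classical
  induction s using Finset.induction_on with
  | empty => simp
  | insert i s hi ih => rw [Finset.sum_insert hi, Finset.prod_insert hi, sgn_add, ih]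

/-- Row $x$ of the stabilizer has a single nonzero entry, in the column where bit $i$ is flipped. -/
theorem stabilizer_mulVec (i : Fin n) (f : BitString n → ℂ) (x : BitString n) :
    (stabilizer n i).mulVec f x = sgn (neighborSum i x) * f (x + Pi.single i 1) := by
  have hZ : ∀ b c : Fin 2, b ≠ c → pauliZ b c = 0 := by
    intro b c h
    fin_cases b <;> fin_cases c <;> simp_all [pauliZ]
  have hZ' : ∀ b : Fin 2, pauliZ b b = sgn b := by
    intro b
    fin_cases b <;> simp [pauliZ]
  have hX : ∀ b c : Fin 2, c ≠ b + 1 → pauliX b c = 0 := by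
    intro b c h
    fin_cases b <;> fin_cases c <;> simp_all [pauliX]
  have hX' : ∀ b : Fin 2, pauliX b (b + 1) = 1 := by
    intro b
    fin_cases b <;> simp [pauliX]
  rw [Matrix.mulVec, dotProduct, Finset.sum_eq_single (x + Pi.single i 1)]
  · congr 1
    rw [neighborSum, sgn_sum]
    simp only [stabilizer, tensorOp, Matrix.of_apply]
    refine Finset.prod_congr rfl fun j _ => ?_
    by_cases hj : j = i
    · subst hj
      simp [hX']
    · by_cases h : (j : ℕ) + 1 = i ∨ (i : ℕ) + 1 = j
      · simp [hj, h, hZ']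
      · have hxj : (x + Pi.single i 1 : BitString n) j = x j := by simp [hj]
        rw [if_neg hj, if_neg h, if_neg h, hxj, Matrix.one_apply_eq, sgn_zero]
  · intro y _ hy
    obtain ⟨j, hj⟩ := Function.ne_iff.mp hy
    rw [stabilizer, tensorOp, Matrix.of_apply, Finset.prod_eq_zero (Finset.mem_univ j), zero_mul]
    by_cases hji : j = i
    · subst hji
      rw [if_pos rfl]
      apply hX
      simpa using hj
    · have hj' : x j ≠ y j := by
        intro h
        apply hj
        simp [hji, h]
      rw [if_neg hji]
      split_ifs
      · exact hZ _ _ hj'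
      · exact Matrix.one_apply_ne hj'
  · simp

theorem stabilizer_mulVec_clusterKet (a : BitString n) (i : Fin n) :
    (stabilizer n i).mulVec (clusterKet a).ofLp
      = ((-1 : ℂ) ^ (a i : ℕ)) • (clusterKet a).ofLp := by
  funext x
  rw [stabilizer_mulVec, Pi.smul_apply, smul_eq_mul]
  simp only [clusterKet, edgeForm_add_single, dotProduct_add, dotProduct_single, mul_one, sgn_add]
  change _ = sgn (a i) * _
  linear_combination (((√2 : ℂ) ^ n)⁻¹ * sgn (a ⬝ᵥ x) * sgn (a i) * sgn (edgeForm x))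
    * sgn_mul_self (neighborSum i x)

theorem inner_clusterKet (a : BitString n) (ψ : Ket n) :
    inner ℂ (clusterKet a) ψ
      = ((√2 : ℂ) ^ n)⁻¹ * ∑ x, sgn (a ⬝ᵥ x + edgeForm x) * ψ x := by
  rw [PiLp.inner_apply, Finset.mul_sum]
  refine Finset.sum_congr rfl fun x _ => ?_
  simp only [clusterKet, RCLike.inner_apply, map_mul, map_inv₀, map_pow, Complex.conj_ofReal,
    conj_sgn]
  ring

theorem orthonormal_clusterKet : Orthonormal ℂ (clusterKet : BitString n → Ket n) := by
  rw [orthonormal_iff_ite]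
  intro a a'
  have h2 : ((√2 : ℝ) : ℂ) * (√2 : ℝ) = 2 := by
    rw [← Complex.ofReal_mul, Real.mul_self_sqrt (by norm_num)]
    norm_num
  have hs : ((√2 : ℝ) : ℂ) ≠ 0 := by
    intro h
    rw [h] at h2
    norm_num at h2
  have hterm : ∀ x : BitString n, sgn (a ⬝ᵥ x + edgeForm x) * (clusterKet a') x
      = ((√2 : ℂ) ^ n)⁻¹ * sgn ((a + a') ⬝ᵥ x) := by
    intro x
    simp only [clusterKet, add_dotProduct, sgn_add]
    linear_combination (((√2 : ℂ) ^ n)⁻¹ * sgn (a ⬝ᵥ x) * sgn (a' ⬝ᵥ x))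
      * sgn_mul_self (edgeForm x)
  rw [inner_clusterKet]
  simp only [hterm]
  rw [← Finset.mul_sum, sum_sgn_dotProduct]
  by_cases h : a = a'
  · subst h
    rw [if_pos (bit_add_self a), if_pos rfl, Fintype.card_fin, ← h2, mul_pow]
    field_simp
  · rw [if_neg h, if_neg, mul_zero, mul_zero]
    intro h0
    have := bit_add_add_cancel a a'
    rw [h0, zero_add] at this
    exact h this.symm

theorem isClusterBasis_clusterKet : IsClusterBasis n clusterKet :=
  fun a => ⟨orthonormal_clusterKet.1 a, stabilizer_mulVec_clusterKet a⟩

/-! ### Uniqueness of the graph-state basis up to phases -/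

theorem eq_of_forall_add_single {E : Type*} {f : BitString n → E}
    (h : ∀ x i, f (x + Pi.single i 1) = f x) (x : BitString n) : f x = f 0 := by
  have key : ∀ s : Finset (Fin n), f (∑ i ∈ s, Pi.single i (x i)) = f 0 := by
    intro s
    induction s using Finset.induction_on with
    | empty => simp
    | insert i s hi ih =>
      rw [Finset.sum_insert hi, add_comm]
      by_cases hx : x i = 0
      · rw [hx, Pi.single_zero, add_zero, ih]
      · rw [bit_eq_one_of_ne_zero hx, h, ih]
  rw [← key Finset.univ, Finset.univ_sum_single]

/-- After multiplication by the signs of `clusterKet a`, the eigenvalue equations say that the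
amplitudes are invariant under every bit flip, hence constant; the norms make the scalar a phase. -/
theorem IsClusterBasis.exists_phase {b : BitString n → Ket n} (hb : IsClusterBasis n b)
    (a : BitString n) : ∃ c : ℂ, ‖c‖ = 1 ∧ b a = c • clusterKet a := by
  have hinv := eq_of_forall_add_single (f := fun x => sgn (a ⬝ᵥ x + edgeForm x) * b a x) (by
    intro x i
    have h := congrFun ((hb a).2 i) x
    rw [stabilizer_mulVec, Pi.smul_apply, smul_eq_mul] at h
    change _ = sgn (a i) * _ at h
    simp only [edgeForm_add_single, dotProduct_add, dotProduct_single, mul_one, sgn_add]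
    linear_combination (sgn (a ⬝ᵥ x) * sgn (a i) * sgn (edgeForm x)) * h
      + (sgn (a ⬝ᵥ x) * sgn (edgeForm x) * b a x) * sgn_mul_self (a i))
  have hs : ((√2 : ℝ) : ℂ) ≠ 0 := by
    simp
  have heq : b a = (((√2 : ℂ) ^ n) * (sgn (a ⬝ᵥ 0 + edgeForm (0 : BitString n)) * b a 0)) • clusterKet a := by
    ext x
    have h := hinv x
    simp only at h
    rw [← h]
    simp only [PiLp.smul_apply, smul_eq_mul, clusterKet]
    have := sgn_mul_self (a ⬝ᵥ x + edgeForm x)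
    field_simp
    linear_combination (-(b a x)) * this
  refine ⟨_, ?_, heq⟩
  have := congrArg norm heq
  rwa [norm_smul, (hb a).1, orthonormal_clusterKet.1 a, mul_one, eq_comm] at this

theorem proj_smul {c : ℂ} (hc : ‖c‖ = 1) (ψ : Ket n) : proj (c • ψ) = proj ψ := by
  have : c * star c = 1 := by
    rw [Complex.star_def, Complex.mul_conj, Complex.normSq_eq_norm_sq, hc]
    simp
  ext x y
  simp only [proj, Matrix.vecMulVec_apply, PiLp.smul_apply, Pi.star_apply, smul_eq_mul, star_mul]
  linear_combination (ψ x * star (ψ y)) * this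

theorem IsClusterBasis.proj_eq {b : BitString n → Ket n} (hb : IsClusterBasis n b)
    (a : BitString n) : proj (b a) = proj (clusterKet a) := by
  obtain ⟨c, hc, h⟩ := hb.exists_phase a
  rw [h, proj_smul hc]

theorem IsClusterBasis.orthonormal {b : BitString n → Ket n} (hb : IsClusterBasis n b) :
    Orthonormal ℂ b := by
  refine ⟨fun a => (hb a).1, fun a a' h => ?_⟩
  obtain ⟨c, -, hc⟩ := hb.exists_phase a
  obtain ⟨c', -, hc'⟩ := hb.exists_phase a'
  rw [hc, hc', inner_smul_left, inner_smul_right, orthonormal_clusterKet.2 h, mul_zero, mul_zero]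

theorem IsClusterBasis.span_eq_top {b : BitString n → Ket n} (hb : IsClusterBasis n b) :
    Submodule.span ℂ (Set.range b) = ⊤ :=
  hb.orthonormal.linearIndependent.span_eq_top_of_card_eq_finrank' (by simp)

/-! ### Overlaps of a biseparable vector with the graph-state basis -/

theorem dotProduct_split (A : Finset (Fin n)) (a x : BitString n) :
    a ⬝ᵥ x = (fun i : {i : Fin n // i ∈ A} => a i.1) ⬝ᵥ (fun i => x i.1)
      + (fun i : {i : Fin n // i ∉ A} => a i.1) ⬝ᵥ (fun i => x i.1) := by
  simp only [dotProduct]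
  convert (Fintype.sum_subtype_add_sum_subtype (· ∈ A) fun i => a i * x i).symm

/-- The part of `edgeForm` that comes from the edges inside a set of vertices. -/
def innerEdgeForm (p : Fin n → Prop) [Fintype {i : Fin n // p i}] (y : {i : Fin n // p i} → Fin 2) : Fin 2 :=
  ∑ i, ∑ j, if (i.1 : ℕ) + 1 = j.1 then y i * y j else 0

theorem edgeForm_split (A : Finset (Fin n)) (x : BitString n) :
    edgeForm x = innerEdgeForm (· ∈ A) (fun i => x i.1) + innerEdgeForm (· ∉ A) (fun i => x i.1)
      + (fun i : {i : Fin n // i ∈ A} => x i.1) ⬝ᵥ (cutMatrix A).mulVec (fun i => x i.1) := by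
  -- `edgeForm` orients edges upwards, so the crossing edges split by the side on which the lower
  -- endpoint lies.
  have hcut : (fun i : {i : Fin n // i ∈ A} => x i.1) ⬝ᵥ (cutMatrix A).mulVec (fun i => x i.1)
      = (∑ i : {i : Fin n // i ∈ A}, ∑ j : {i : Fin n // i ∉ A},
          if (i.1 : ℕ) + 1 = j.1 then x i.1 * x j.1 else 0)
        + ∑ j : {i : Fin n // i ∉ A}, ∑ i : {i : Fin n // i ∈ A},
          if (j.1 : ℕ) + 1 = i.1 then x j.1 * x i.1 else 0 := by
    conv_rhs => arg 2; rw [Finset.sum_comm]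
    rw [← Finset.sum_add_distrib]
    refine Finset.sum_congr rfl fun i _ => ?_
    rw [Matrix.mulVec, dotProduct, Finset.mul_sum, ← Finset.sum_add_distrib]
    refine Finset.sum_congr rfl fun j _ => ?_
    simp only [cutMatrix, Matrix.of_apply]
    by_cases h : (i.1 : ℕ) + 1 = j.1
    · have h' : ¬ (j.1 : ℕ) + 1 = i.1 := by omega
      simp [h, h']
    · by_cases h' : (j.1 : ℕ) + 1 = i.1
      · simp [h, h', mul_comm]
      · simp [h, h']
  have hsplit : ∀ f : Fin n → Fin 2, ∑ i, f i
      = ∑ i : {i : Fin n // i ∈ A}, f i.1 + ∑ i : {i : Fin n // i ∉ A}, f i.1 := by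
    intro f
    convert (Fintype.sum_subtype_add_sum_subtype (· ∈ A) f).symm
  rw [hcut, edgeForm, hsplit]
  simp only [hsplit, Finset.sum_add_distrib, innerEdgeForm]
  exact (by decide : ∀ p q r s : Fin 2, p + q + (r + s) = p + s + (q + r)) _ _ _ _

theorem norm_inner_clusterKet_sq (A : Finset (Fin n)) (ψ : Ket n)
    (u : ({i : Fin n // i ∈ A} → Fin 2) → ℂ) (v : ({i : Fin n // i ∉ A} → Fin 2) → ℂ)
    (hψ : ∀ x : BitString n, ψ x = u (fun i => x i.1) * v (fun i => x i.1)) (a : BitString n) :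
    ‖inner ℂ (clusterKet a) ψ‖ ^ 2 = ‖((√2 : ℂ) ^ n)⁻¹‖ ^ 2 *
      ‖overlap (cutMatrix A) (fun y => sgn (innerEdgeForm (· ∈ A) y) * u y)
        (fun z => sgn (innerEdgeForm (· ∉ A) z) * v z)
        (fun i => a i.1) (fun i => a i.1)‖ ^ 2 := by
  rw [inner_clusterKet, norm_mul, mul_pow]
  congr 3
  rw [overlap, ← Fintype.sum_prod_type']
  refine Fintype.sum_equiv (Equiv.piEquivPiSubtypeProd (· ∈ A) fun _ => Fin 2) _ _ fun x => ?_
  rw [hψ, edgeForm_split A, dotProduct_split A]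
  simp only [Equiv.piEquivPiSubtypeProd_apply, sgn_add]
  ring

theorem IsBiseparableKet.norm_inner_sq_le {ψ : Ket n} (h : IsBiseparableKet ψ) :
    ‖inner ℂ (clusterKet 0) ψ‖ ^ 2 ≤ ∑ a ∈ Finset.univ.erase (0 : BitString n),
      ((2 : ℝ) ^ spreadNumber a - 1)⁻¹ * ‖inner ℂ (clusterKet a) ψ‖ ^ 2 := by
  obtain ⟨A, hA, hA', u, v, hψ⟩ := h
  set p : BitString n → ℝ := fun a => ‖inner ℂ (clusterKet a) ψ‖ ^ 2 with hp
  set N : ℝ := ((imageMulVec (cutMatrix A).transpose).card : ℝ) with hN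
  have hN1 : 1 < N := by
    rw [hN]
    exact_mod_cast one_lt_card_imageMulVec_cutMatrix hA hA'
  -- The labels occurring in the overlap inequality; both restrictions lie in the images attached to
  -- the cut.
  set L : Finset (BitString n) := Finset.univ.filter fun a =>
    (fun i : {i : Fin n // i ∈ A} => a i.1) ∈ imageMulVec (cutMatrix A) ∧
    (fun i : {i : Fin n // i ∉ A} => a i.1) ∈ imageMulVec (cutMatrix A).transpose with hL
  have h0L : (0 : BitString n) ∈ L :=
    Finset.mem_filter.mpr ⟨Finset.mem_univ _, zero_mem_imageMulVec _, zero_mem_imageMulVec _⟩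
  have hmain : N * p 0 ≤ ∑ a ∈ L, p a := by
    have hov := card_mul_norm_overlap_zero_sq_le (cutMatrix A)
      (fun y => sgn (innerEdgeForm (· ∈ A) y) * u y)
      (fun z => sgn (innerEdgeForm (· ∉ A) z) * v z)
    have hpa := norm_inner_clusterKet_sq A ψ u v hψ
    calc N * p 0 = ‖((√2 : ℂ) ^ n)⁻¹‖ ^ 2 * (N * ‖overlap (cutMatrix A)
            (fun y => sgn (innerEdgeForm (· ∈ A) y) * u y)
            (fun z => sgn (innerEdgeForm (· ∉ A) z) * v z) 0 0‖ ^ 2) := by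
          simp only [hp, hpa]
          exact mul_left_comm _ _ _
      _ ≤ ‖((√2 : ℂ) ^ n)⁻¹‖ ^ 2 * _ := mul_le_mul_of_nonneg_left hov (by positivity)
      _ = ∑ a ∈ L, p a := by
          simp only [hp, hpa]
          rw [← Finset.mul_sum, ← Finset.sum_product']
          congr 1
          symm
          refine Finset.sum_equiv (Equiv.piEquivPiSubtypeProd (· ∈ A) fun _ => Fin 2)
            (fun a => ?_) fun a _ => rfl
          rw [Finset.mem_product, hL, Finset.mem_filter]
          exact and_iff_right (Finset.mem_univ _)
  have hcoef : ∀ a ∈ L.erase 0, p a ≤ (N - 1) * (((2 : ℝ) ^ spreadNumber a - 1)⁻¹ * p a) := by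
    intro a ha
    obtain ⟨ha0, haL⟩ := Finset.mem_erase.mp ha
    obtain ⟨T, hT, hTc⟩ := exists_isSpread_card_eq a
    obtain ⟨-, hα, hβ⟩ := Finset.mem_filter.mp haL
    have hle : (2 : ℝ) ^ spreadNumber a ≤ N := by
      rw [← hTc, hN]
      exact_mod_cast two_pow_card_le_card_imageMulVec hα hβ hT
    have hpos : 0 < (2 : ℝ) ^ spreadNumber a - 1 :=
      sub_pos.mpr (one_lt_pow₀ one_lt_two (Nat.one_le_iff_ne_zero.mp (one_le_spreadNumber ha0)))
    rw [← mul_assoc, ← div_eq_mul_inv]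
    exact le_mul_of_one_le_left (by positivity) ((one_le_div hpos).mpr (by linarith))
  have hnonneg : ∀ a, 0 ≤ ((2 : ℝ) ^ spreadNumber a - 1)⁻¹ * p a := fun a =>
    mul_nonneg (inv_nonneg.mpr (sub_nonneg.mpr (one_le_pow₀ one_le_two))) (by positivity)
  -- The cut-dependent factor $N-1$ cancels, leaving coefficients valid for every bipartition.
  refine le_of_mul_le_mul_left ?_ (sub_pos.mpr hN1)
  calc (N - 1) * p 0 ≤ ∑ a ∈ L.erase 0, p a := by
        rw [← Finset.add_sum_erase L p h0L] at hmain
        linarith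
    _ ≤ ∑ a ∈ L.erase 0, (N - 1) * (((2 : ℝ) ^ spreadNumber a - 1)⁻¹ * p a) :=
        Finset.sum_le_sum hcoef
    _ = (N - 1) * ∑ a ∈ L.erase 0, ((2 : ℝ) ^ spreadNumber a - 1)⁻¹ * p a :=
        (Finset.mul_sum _ _ _).symm
    _ ≤ _ := mul_le_mul_of_nonneg_left (Finset.sum_le_sum_of_subset_of_nonneg
        (Finset.erase_subset_erase _ (Finset.subset_univ _)) fun a _ _ => hnonneg a)
        (by linarith)

end ClusterKet

/-! ### The witness -/

section Witness

variable {n : ℕ}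

theorem trace_mul_proj (W : Op n) (ψ : Ket n) :
    (W * proj ψ).trace = W.mulVec ψ.ofLp ⬝ᵥ star ψ.ofLp := by
  rw [proj, Matrix.mul_vecMulVec, Matrix.trace_vecMulVec]

theorem proj_mulVec (φ ψ : Ket n) :
    (proj φ).mulVec ψ.ofLp = inner ℂ φ ψ • φ.ofLp := by
  rw [proj, Matrix.vecMulVec_mulVec, EuclideanSpace.inner_eq_star_dotProduct, dotProduct_comm]
  ext x
  simp [mul_comm]

theorem trace_proj_mul_proj (φ ψ : Ket n) :
    (proj φ * proj ψ).trace = ((‖inner ℂ φ ψ‖ ^ 2 : ℝ) : ℂ) := by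
  rw [trace_mul_proj, proj_mulVec, smul_dotProduct, ← EuclideanSpace.inner_eq_star_dotProduct,
    smul_eq_mul, ← inner_conj_symm ψ φ, Complex.mul_conj, Complex.normSq_eq_norm_sq]

theorem isHermitian_proj (ψ : Ket n) : (proj ψ).IsHermitian := by
  ext x y
  simp [proj, Matrix.vecMulVec_apply, mul_comm]

open scoped ComplexOrder in
theorem isState_proj {ψ : Ket n} (hψ : ‖ψ‖ = 1) : IsState (proj ψ) := by
  refine ⟨Matrix.posSemidef_vecMulVec_self_star _, ?_⟩
  rw [← one_mul (proj ψ), trace_mul_proj, Matrix.one_mulVec,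
    ← EuclideanSpace.inner_eq_star_dotProduct, inner_self_eq_norm_sq_to_K, hψ]
  simp

theorem witness_eq (b : BitString n → Ket n) :
    witness n b = (∑ a ∈ Finset.univ.erase 0,
      (((2 : ℝ) ^ spreadNumber a - 1)⁻¹ : ℝ) • proj (b a)) - proj (b 0) := by
  rw [witness, sum_sum_V (fun k a => ((2 : ℂ) ^ k - 1)⁻¹ • proj (b a))]
  congr 1
  refine Finset.sum_congr rfl fun a _ => ?_
  ext x y
  simp

theorem isHermitian_witness (b : BitString n → Ket n) : (witness n b).IsHermitian := by
  rw [witness_eq, Matrix.IsHermitian, Matrix.conjTranspose_sub, Matrix.conjTranspose_sum,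
    isHermitian_proj]
  congr 1
  refine Finset.sum_congr rfl fun a _ => ?_
  rw [Matrix.conjTranspose_smul, isHermitian_proj, star_trivial]

theorem IsClusterBasis.witness_eq_clusterKet {b : BitString n → Ket n}
    (hb : IsClusterBasis n b) : witness n b = witness n clusterKet := by
  simp only [witness, hb.proj_eq]

theorem IsBiseparableKet.trace_witness_nonneg {ψ : Ket n} (h : IsBiseparableKet ψ) :
    0 ≤ (witness n clusterKet * proj ψ).trace.re := by
  rw [witness_eq, sub_mul, Finset.sum_mul, Matrix.trace_sub, Matrix.trace_sum]
  simp only [Matrix.smul_mul, Matrix.trace_smul, trace_proj_mul_proj]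
  simp only [Complex.real_smul, ← Complex.ofReal_mul]
  rw [Complex.sub_re, Complex.re_sum, sub_nonneg]
  simp only [Complex.ofReal_re]
  exact h.norm_inner_sq_le

theorem IsBiseparable.trace_witness_nonneg {ρ : Op n} (h : IsBiseparable ρ) :
    0 ≤ (witness n clusterKet * ρ).trace.re := by
  -- The condition defines a real half-space, so pure product vectors suffice.
  refine convexHull_min (t := {ρ : Op n | 0 ≤ (witness n clusterKet * ρ).trace.re}) ?_ ?_ h
  · rintro _ ⟨ψ, -, hψ, rfl⟩
    exact hψ.trace_witness_nonneg
  · intro ρ hρ σ hσ s t hs ht _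
    simp only [Set.mem_ofPred_eq] at hρ hσ ⊢
    rw [mul_add, Matrix.trace_add, Matrix.mul_smul, Matrix.mul_smul, Matrix.trace_smul,
      Matrix.trace_smul, Complex.add_re, Complex.real_smul, Complex.real_smul,
      Complex.re_ofReal_mul, Complex.re_ofReal_mul]
    positivity

theorem _root_.Orthonormal.proj_mulVec {b : BitString n → Ket n} (hb : Orthonormal ℂ b)
    (a a' : BitString n) : (proj (b a)).mulVec (b a').ofLp = if a = a' then (b a').ofLp else 0 := by
  rw [ClusterWitness.proj_mulVec, orthonormal_iff_ite.mp hb]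
  split_ifs with h
  · rw [h, one_smul]
  · rw [zero_smul]

theorem _root_.Orthonormal.witness_mulVec_zero {b : BitString n → Ket n} (hb : Orthonormal ℂ b) :
    (witness n b).mulVec (b 0).ofLp = -(b 0).ofLp := by
  rw [witness_eq, Matrix.sub_mulVec, Matrix.sum_mulVec, Finset.sum_eq_zero, hb.proj_mulVec,
    if_pos rfl, zero_sub]
  intro a ha
  rw [Matrix.smul_mulVec, hb.proj_mulVec, if_neg (Finset.ne_of_mem_erase ha), smul_zero]

theorem _root_.Orthonormal.witness_mulVec {b : BitString n → Ket n} (hb : Orthonormal ℂ b)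
    {a : BitString n} (ha : a ≠ 0) : (witness n b).mulVec (b a).ofLp
      = ((2 : ℂ) ^ spreadNumber a - 1)⁻¹ • (b a).ofLp := by
  rw [witness_eq, Matrix.sub_mulVec, Matrix.sum_mulVec, Finset.sum_eq_single a,
    hb.proj_mulVec 0 a, if_neg ha.symm, sub_zero, Matrix.smul_mulVec, hb.proj_mulVec, if_pos rfl]
  · ext x
    simp
  · intro a' _ h
    rw [Matrix.smul_mulVec, hb.proj_mulVec, if_neg h, smul_zero]
  · intro h
    exact absurd (Finset.mem_erase.mpr ⟨ha, Finset.mem_univ _⟩) h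

end Witness

end ClusterWitness

theorem mainTheorem5 (n : ℕ) (hn : 2 ≤ n) :
    (∃ b : ClusterWitness.BitString n → ClusterWitness.Ket n,
      ClusterWitness.IsClusterBasis n b) ∧
    ∀ b : ClusterWitness.BitString n → ClusterWitness.Ket n,
      ClusterWitness.IsClusterBasis n b →
        -- the common eigenvectors of the stabilizers form an orthonormal basis
        (Orthonormal ℂ b ∧ Submodule.span ℂ (Set.range b) = ⊤) ∧
        -- the operator is a GME witness
        ClusterWitness.IsGMEWitness (ClusterWitness.witness n b) ∧
        -- it detects the linear cluster state, which is genuinely multipartite entangled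
        ClusterWitness.IsGME (ClusterWitness.proj (b 0)) ∧
        (ClusterWitness.witness n b * ClusterWitness.proj (b 0)).trace = -1 ∧
        -- it is diagonal in the graph-state basis, with the following eigenvalues
        (ClusterWitness.witness n b).mulVec (b 0).ofLp = -(b 0).ofLp ∧
        (∀ k : ℕ, 1 ≤ k → ∀ a ∈ ClusterWitness.V n k,
          (ClusterWitness.witness n b).mulVec (b a).ofLp
            = ((2 : ℂ) ^ k - 1)⁻¹ • (b a).ofLp) ∧
        -- every nonzero bit string lies in exactly one of the classes that occur in the sum
        (∀ a : ClusterWitness.BitString n, a ≠ 0 →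
          ∃! k : ℕ, k ∈ Finset.Icc 1 ⌈(n : ℚ) / 3⌉₊ ∧ a ∈ ClusterWitness.V n k) := by
  refine ⟨⟨_, ClusterWitness.isClusterBasis_clusterKet⟩, fun b hb => ?_⟩
  have hW := hb.witness_eq_clusterKet
  have hzero := hb.orthonormal.witness_mulVec_zero
  have htr : (ClusterWitness.witness n b * ClusterWitness.proj (b 0)).trace = -1 := by
    rw [ClusterWitness.trace_mul_proj, hzero, neg_dotProduct,
      ← EuclideanSpace.inner_eq_star_dotProduct, inner_self_eq_norm_sq_to_K, (hb 0).1]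
    simp
  have hbisep : ∀ ρ : ClusterWitness.Op n, ClusterWitness.IsBiseparable ρ →
      0 ≤ (ClusterWitness.witness n b * ρ).trace.re := fun ρ hρ => by
    rw [hW]
    exact hρ.trace_witness_nonneg
  -- Entanglement of the cluster state follows from the witness itself: expectation $-1$ excludes
  -- biseparability.
  have hGME : ClusterWitness.IsGME (ClusterWitness.proj (b 0)) := by
    refine ⟨ClusterWitness.isState_proj (hb 0).1, fun h => ?_⟩
    have := hbisep _ h
    rw [htr] at this
    norm_num at this
  refine ⟨⟨hb.orthonormal, hb.span_eq_top⟩, ⟨ClusterWitness.isHermitian_witness b, hbisep,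
    _, hGME, by rw [htr]; norm_num⟩, hGME, htr, hzero, fun k hk a ha => ?_,
    fun a ha => ClusterWitness.existsUnique_mem_V ha⟩
  obtain rfl := ClusterWitness.mem_V.mp ha
  refine hb.orthonormal.witness_mulVec ?_
  rintro rfl
  rw [ClusterWitness.spreadNumber_zero] at hk
  exact absurd hk (by norm_num)
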